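/- For integers $m,n\ge 2$ let $N:=m+n$ and \[ T(m,0,n):=\sum_{r=1}^{\infty}\sum_{s=1}^{\infty}\frac{1}{r^{m}(r+s)^{n}} . \] Let $B_k(q)$ be the Bernoulli polynomials, given by $\frac{t e^{qt}}{e^t-1}=\sum_{k\ge0}B_k(q)\frac{t^k}{k!}$, and let $\mathrm{Cl}_l$ be the Clausen functions: $\mathrm{Cl}_{l}(x):=\sum_{k\ge1}\frac{\sin kx}{k^{l}}$ for even $l\ge 2$ and $\mathrm{Cl}_{l}(x):=\sum_{k\ge1}\frac{\cos kx}{k^{l}}$ for odd $l\ge 1$. For integers $k,l\ge 0$ put \[ X_{k,l}:=(-1)^{\lfloor l/2\rfloor}\frac{l!}{(2\pi)^l}\int_0^1\log\Gamma(q)\,B_k(q)\,\mathrm{Cl}_{l+1}(2\pi q)\,dq . \] Assume that $m,n\ge 2$ and that $N=m+n$ is even. Define \[ Y_{m,n}:=\frac{2(2\pi)^{N-2}}{m!\,(N-m-2)!}\sum_{j=0}^{m}(-1)^j\binom{m}{j}X_{j,N-2-j}, \qquad Y^*_{m,n}:=Y_{m,n}+(-1)^{N/2-1}\binom{N-2}{m-1}\zeta(N-1)\log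 2\pi , \] \[ T_1(m,n):=\zeta(m)\zeta(n)-\tfrac12\zeta(N), \] \[ T_2(m,n):=-\sum_{k=1}^{N/2-2}\binom{N-2-2k}{m-1}\zeta(2k+1)\zeta(N-1-2k)+(-1)^{N/2-1}Y^*_{m,n}. \] Then the double series $T(m,0,n)$ converges, and for all $k,l\ge0$ with $k+l=N-2$ the series $\mathrm{Cl}_{l+1}(2\pi q)$ converges for every $q\in(0,1)$ and the integral defining $X_{k,l}$ converges absolutely. Moreover \[ T(m,0,n)=\begin{cases}T_1(m,n)+T_2(m,n), & m\text{ and }n\text{ odd},\\ T_1(m,n)+T_2(n,m), & m\text{ and }n\text{ even}.\end{cases} \] -/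

import Mathlib

noncomputable section

namespace Tornheim

/-- The term of the Tornheim series with indices `r + 1`, `s + 1` (so that both run from `1`). -/
def term (a b c : ℕ) (r s : ℕ) : ℝ :=
  1 / (((r : ℝ) + 1) ^ a * ((s : ℝ) + 1) ^ b * (((r : ℝ) + 1) + ((s : ℝ) + 1)) ^ c)

/-- The Tornheim double series `T(a,b,c) = ∑_{r≥1} ∑_{s≥1} 1 / (r^a s^b (r+s)^c)`. -/
def T (a b c : ℕ) : ℝ := ∑' r : ℕ, ∑' s : ℕ, term a b c r s

/-- The term with index `k + 1` of the Clausen series of order `l`: a sine series for even `l`,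
a cosine series for odd `l`. -/
def clausenTerm (l : ℕ) (x : ℝ) (k : ℕ) : ℝ :=
  if Even l then Real.sin (((k : ℝ) + 1) * x) / ((k : ℝ) + 1) ^ l
  else Real.cos (((k : ℝ) + 1) * x) / ((k : ℝ) + 1) ^ l

/-- The Clausen function `Cl_l(x)`. The series is the limit of its partial sums, since for `l = 1`
it converges only conditionally. -/
def clausen (l : ℕ) (x : ℝ) : ℝ :=
  ∑'[SummationFilter.conditional ℕ] k : ℕ, clausenTerm l x k

/-- The integrand `log Γ(q) B_k(q) Cl_{l+1}(2πq)`. -/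
def integrand (k l : ℕ) (q : ℝ) : ℝ :=
  Real.log (Real.Gamma q) * bernoulliFun k q * clausen (l + 1) (2 * Real.pi * q)

/-- `X_{k,l}`. -/
def X (k l : ℕ) : ℝ :=
  (-1) ^ (l / 2) * ((l.factorial : ℝ) / (2 * Real.pi) ^ l) * ∫ q in (0 : ℝ)..1, integrand k l q

/-- `Y_{m,n}`, with `N = m + n`. -/
def Y (m n : ℕ) : ℝ :=
  2 * (2 * Real.pi) ^ (m + n - 2) / ((m.factorial : ℝ) * ((m + n - m - 2).factorial : ℝ)) *
    ∑ j ∈ Finset.range (m + 1), (-1) ^ j * (m.choose j : ℝ) * X j (m + n - 2 - j)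

/-- `Y*_{m,n}`, with `N = m + n`. -/
def Ystar (m n : ℕ) : ℂ :=
  (Y m n : ℂ) + (-1) ^ ((m + n) / 2 - 1) * ((m + n - 2).choose (m - 1) : ℂ) *
    riemannZeta ((m + n - 1 : ℕ) : ℂ) * (Real.log (2 * Real.pi) : ℂ)

/-- `T₁(m,n)`. -/
def T₁ (m n : ℕ) : ℂ :=
  riemannZeta (m : ℂ) * riemannZeta (n : ℂ) - 1 / 2 * riemannZeta ((m + n : ℕ) : ℂ)

/-- `T₂(m,n)`, with `N = m + n`. -/
def T₂ (m n : ℕ) : ℂ :=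
  -∑ k ∈ Finset.Icc 1 ((m + n) / 2 - 2),
      ((m + n - 2 - 2 * k).choose (m - 1) : ℂ) *
        riemannZeta ((2 * k + 1 : ℕ) : ℂ) * riemannZeta ((m + n - 1 - 2 * k : ℕ) : ℂ)
    + (-1) ^ ((m + n) / 2 - 1) * Ystar m n

end Tornheim

end

/-! Write `n = ν + 2`. After normalisation, the Bernoulli function of degree `j ≥ 1` has Fourier
coefficients `-1 / k ^ j` on the unit interval, and the Clausen function of order `l + 1` has `sign
k / k ^ (l + 1)`. Up to a sign, `Y m n` is the integral of `log Γ` against `kernel`, a binomial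
combination of products of the two.

`log Γ` is never expanded. Since `N` is even, `kernel` is invariant under `x ↦ 1 - x`, so `log Γ(x)`
may be replaced by the mean of `log Γ(x)` and `log Γ(1 - x)`, which the reflection formula evaluates
as half of `log 2π + Cl_1(2πx)` (`two_mul_integral_log_Gamma_mul`). The constant contributes `log
2π` times the mean of `kernel`; this is the correction that turns `Y` into `Y*`. The part with
`Cl_1` is a Parseval sum with weights `1 / q`.

The coefficients of `kernel` at `p` are convolutions with terms `1 / ((k - p) ^ (m - t) k ^ (ν + t +
1))`. The binomial weights make them one half of the partial fraction expansion of `1 / ((k - p) ^ m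
p ^ (ν + 1))`. Exchanging the halves leaves terms with a single pole, at `k = p` or at `k = 0`, each
summable in closed form (`sum_convolution_eq`). The poles at `0` give zeta values. The poles at `p`
meet a factor `sign k` that jumps at `0` instead of at `p`, and this leaves a harmonic number `harm
m`. Summed against `1 / q ^ n`, it is the Tornheim series.

So `T₂_eq` expresses `T₂(m, n)` through `T(m, 0, n)`. Odd `m` is then immediate; even `m` also needs
the decomposition of `ζ(m) ζ(n)` in `T_add_T_swap`. -/

noncomputable section

namespace Tornheim

open MeasureTheory Set Filter Topology Complex
open scoped ComplexConjugate ENNReal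

/-! ### Fourier coefficients on the unit interval -/

/-- Lebesgue measure on the unit interval. -/
abbrev unitMeasure : Measure ℝ := volume.restrict (Ioc (0 : ℝ) 1)

/-- The exponential `exp (2πikx)`. -/
def expo (k : ℤ) (x : ℝ) : ℂ := fourier k (x : UnitAddCircle)

lemma expo_eq (k : ℤ) (x : ℝ) : expo k x = cexp (2 * Real.pi * I * k * x) := by
  simp [expo]

lemma continuous_expo (k : ℤ) : Continuous (expo k) :=
  (map_continuous (fourier k)).comp (AddCircle.continuous_mk' 1)

lemma norm_expo (k : ℤ) (x : ℝ) : ‖expo k x‖ = 1 := by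
  rw [expo, fourier_apply, Circle.norm_coe]

/-- The `k`-th Fourier coefficient of a function on the unit interval. -/
def coeff (f : ℝ → ℂ) (k : ℤ) : ℂ := ∫ x in (0 : ℝ)..1, expo (-k) x * f x

lemma coeff_zero_index (f : ℝ → ℂ) : coeff f 0 = ∫ x in (0 : ℝ)..1, f x := by
  simp [coeff, expo]

lemma ae_unit_of_Ioo {P : ℝ → Prop} (h : ∀ x ∈ Ioo (0 : ℝ) 1, P x) :
    ∀ᵐ x ∂unitMeasure, P x := by
  rw [unitMeasure, ← restrict_Ioo_eq_restrict_Ioc]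
  exact (ae_restrict_iff' measurableSet_Ioo).2 (ae_of_all _ h)

lemma fourierCoeff_liftIoc (f : ℝ → ℂ) (k : ℤ) :
    fourierCoeff (AddCircle.liftIoc 1 0 f) k = coeff f k := by
  rw [fourierCoeff_eq_intervalIntegral _ _ 0, coeff]
  simp only [one_div, inv_one, one_smul, zero_add, smul_eq_mul]
  rw [intervalIntegral.integral_of_le zero_le_one, intervalIntegral.integral_of_le zero_le_one]
  refine setIntegral_congr_fun measurableSet_Ioc fun x hx => ?_
  simp only [expo]
  rw [AddCircle.liftIoc_coe_apply (by simpa using hx)]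

lemma memLp_lift {f : ℝ → ℂ} (hf : MemLp f 2 unitMeasure) :
    MemLp (AddCircle.liftIoc 1 0 f) 2 (AddCircle.haarAddCircle (T := 1)) := by
  refine MemLp.haarAddCircle (MemLp.memLp_liftIoc ?_)
  simpa using hf

/-- The Fourier coefficients of a product on the circle are given by convolution. -/
lemma hasSum_fourierCoeff_mul {F H : UnitAddCircle → ℂ}
    (hF : MemLp F 2 (AddCircle.haarAddCircle (T := 1)))
    (hH : MemLp H 2 (AddCircle.haarAddCircle (T := 1))) (p : ℤ) :
    HasSum (fun k : ℤ => fourierCoeff F k * fourierCoeff H (p - k))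
      (fourierCoeff (fun x => F x * H x) p) := by
  have hHs : MemLp (fun x => conj (H x)) 2 (AddCircle.haarAddCircle (T := 1)) := hH.star
  -- Parseval is applied to `F` and `W = e_p · conj H`, because `⟨W, F⟩ = ∫ e_{-p} F H`.
  have hW : MemLp (fun x => fourier p x * conj (H x)) 2 (AddCircle.haarAddCircle (T := 1)) := by
    refine hHs.of_le (((map_continuous (fourier p)).aestronglyMeasurable).mul
      hHs.aestronglyMeasurable) (ae_of_all _ fun x => ?_)
    rw [norm_mul, fourier_apply, Circle.norm_coe, one_mul]
  have h := (fourierBasis (T := 1)).hasSum_inner_mul_inner hW.toLp hF.toLp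
  have hb : ∀ (k : ℤ) {K : UnitAddCircle → ℂ}
      (hK : MemLp K 2 (AddCircle.haarAddCircle (T := 1))),
      inner ℂ (fourierBasis (T := 1) k) hK.toLp = fourierCoeff K k := by
    intro k K hK
    rw [← HilbertBasis.repr_apply_apply, fourierBasis_repr]
    exact congrFun (fourierCoeff_congr_ae hK.coeFn_toLp) k
  convert! h using 1
  · funext k
    rw [hb, ← inner_conj_symm, hb, mul_comm]
    congr 1
    simp only [fourierCoeff, smul_eq_mul, ← integral_conj]
    refine integral_congr_ae (ae_of_all _ fun x => ?_)
    simp only [map_mul, conj_conj, ← fourier_neg, neg_neg]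
    rw [← mul_assoc, ← fourier_add]
    congr 2; congr 1; ring
  · rw [L2.inner_def, fourierCoeff]
    refine integral_congr_ae ?_
    filter_upwards [hW.coeFn_toLp, hF.coeFn_toLp] with x h1 h2
    rw [h1, h2]
    simp only [RCLike.inner_apply, map_mul, conj_conj, ← fourier_neg, smul_eq_mul]
    ring

lemma hasSum_coeff_mul {f h : ℝ → ℂ} (hf : MemLp f 2 unitMeasure) (hh : MemLp h 2 unitMeasure)
    (p : ℤ) :
    HasSum (fun k : ℤ => coeff f k * coeff h (p - k)) (coeff (fun x => f x * h x) p) := by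
  have := hasSum_fourierCoeff_mul (memLp_lift hf) (memLp_lift hh) p
  simp only [fourierCoeff_liftIoc] at this
  rwa [show fourierCoeff (fun x => AddCircle.liftIoc 1 0 f x * AddCircle.liftIoc 1 0 h x) p =
    coeff (fun x => f x * h x) p from fourierCoeff_liftIoc (fun x => f x * h x) p] at this

/-- A function that is, on the open unit interval, the pointwise sum of a trigonometric series with
square summable coefficients is square integrable and has these Fourier coefficients. -/
lemma memLp_and_coeff_of_tendsto {a : ℤ → ℂ} (ha : Summable fun k => ‖a k‖ ^ 2) (h0 : a 0 = 0)
    {f : ℝ → ℂ} (hf : ∀ x ∈ Ioo (0 : ℝ) 1, Tendsto (fun K : ℕ => ∑ k ∈ Finset.range K,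
      (a (k + 1) * expo (k + 1) x + a (-(k + 1)) * expo (-(k + 1)) x)) atTop (𝓝 (f x))) :
    MemLp f 2 unitMeasure ∧ ∀ k, coeff f k = a k := by
  have hmem : Memℓp a 2 := by
    refine memℓp_gen ?_
    simpa using ha
  let A : lp (fun _ : ℤ => ℂ) 2 := ⟨a, hmem⟩
  let φ := (fourierBasis (T := 1)).repr.symm A
  have hφc : ∀ k, fourierCoeff φ k = a k := fun k => by
    rw [← fourierBasis_repr]; simp [φ, A]
  have hsum := (hasSum_fourier_series_L2 φ).nat_add_neg
  simp only [hφc] at hsum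
  rw [h0, zero_smul, add_zero] at hsum
  have hsum' := ((hasSum_nat_add_iff' 1).2 hsum).tendsto_sum_nat
  simp only [Finset.range_one, Finset.sum_singleton, Nat.cast_zero, neg_zero, h0, zero_smul,
    add_zero, sub_zero] at hsum'
  -- Convergence in `L²` gives almost everywhere convergence along a subsequence, which is enough to
  -- identify the `L²` sum with the given pointwise limit `f`.
  obtain ⟨ns, hns, hae⟩ := (tendstoInMeasure_of_tendsto_Lp hsum').exists_seq_tendsto_ae
  have hpart : ∀ᵐ x ∂(AddCircle.haarAddCircle (T := 1)), ∀ K : ℕ,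
      ((∑ k ∈ Finset.range K, (a ((k + 1 : ℕ) : ℤ) • fourierLp 2 ((k + 1 : ℕ) : ℤ) +
        a (-((k + 1 : ℕ) : ℤ)) • fourierLp 2 (-((k + 1 : ℕ) : ℤ))) :
        Lp ℂ 2 (AddCircle.haarAddCircle (T := 1))) : UnitAddCircle → ℂ) x =
      ∑ k ∈ Finset.range K, (a (k + 1) * fourier (k + 1) x + a (-(k + 1)) * fourier (-(k + 1)) x) := by
    rw [ae_all_iff]
    intro K
    induction K with
    | zero =>
      simp
    | succ K ih =>
      rw [Finset.sum_range_succ]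
      filter_upwards [ih, Lp.coeFn_add (∑ k ∈ Finset.range K,
          (a ((k + 1 : ℕ) : ℤ) • fourierLp 2 ((k + 1 : ℕ) : ℤ) +
          a (-((k + 1 : ℕ) : ℤ)) • fourierLp (T := 1) 2 (-((k + 1 : ℕ) : ℤ))))
          (a ((K + 1 : ℕ) : ℤ) • fourierLp 2 ((K + 1 : ℕ) : ℤ) +
          a (-((K + 1 : ℕ) : ℤ)) • fourierLp 2 (-((K + 1 : ℕ) : ℤ))),
        Lp.coeFn_add (a ((K + 1 : ℕ) : ℤ) • fourierLp (T := 1) 2 ((K + 1 : ℕ) : ℤ))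
          (a (-((K + 1 : ℕ) : ℤ)) • fourierLp 2 (-((K + 1 : ℕ) : ℤ))),
        Lp.coeFn_smul (a ((K + 1 : ℕ) : ℤ)) (fourierLp (T := 1) 2 ((K + 1 : ℕ) : ℤ)),
        Lp.coeFn_smul (a (-((K + 1 : ℕ) : ℤ))) (fourierLp (T := 1) 2 (-((K + 1 : ℕ) : ℤ))),
        coeFn_fourierLp (T := 1) 2 ((K + 1 : ℕ) : ℤ),
        coeFn_fourierLp (T := 1) 2 (-((K + 1 : ℕ) : ℤ))] with x h1 h2 h3 h4 h5 h6 h7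
      rw [h2, Pi.add_apply, h1, h3, Pi.add_apply, h4, h5, Pi.smul_apply, Pi.smul_apply, h6, h7,
        Finset.sum_range_succ]
      push_cast
      rfl
  have hmp : MeasurePreserving (fun x : ℝ => (x : UnitAddCircle)) unitMeasure
      (AddCircle.haarAddCircle (T := 1)) := by
    have := UnitAddCircle.measurePreserving_mk 0
    rw [AddCircle.volume_eq_smul_haarAddCircle] at this
    simpa using this
  have hfφ : ∀ᵐ x : ℝ ∂unitMeasure, φ (x : UnitAddCircle) = f x := by
    filter_upwards [hmp.quasiMeasurePreserving.ae hae, hmp.quasiMeasurePreserving.ae hpart,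
      ae_unit_of_Ioo hf] with x h1 h2 h3
    simp only [h2] at h1
    exact tendsto_nhds_unique h1 (h3.comp hns.tendsto_atTop)
  have hφm : MemLp (fun x : ℝ => φ (x : UnitAddCircle)) 2 unitMeasure :=
    (Lp.memLp φ).comp_measurePreserving hmp
  refine ⟨(memLp_congr_ae hfφ).1 hφm, fun k => ?_⟩
  rw [← hφc k, fourierCoeff_eq_intervalIntegral _ _ 0, coeff]
  simp only [one_div, inv_one, one_smul, zero_add, smul_eq_mul]
  rw [intervalIntegral.integral_of_le zero_le_one, intervalIntegral.integral_of_le zero_le_one]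
  refine integral_congr_ae ?_
  filter_upwards [hfφ] with x hx
  rw [← hx]; rfl

/-! ### Clausen functions -/

lemma hasSum_conditional_iff {f : ℕ → ℝ} {a : ℝ} :
    HasSum f a (SummationFilter.conditional ℕ) ↔
      Tendsto (fun n => ∑ i ∈ Finset.range n, f i) atTop (𝓝 a) := by
  rw [HasSum, SummationFilter.conditional_filter_eq_map_range, tendsto_map'_iff]
  rfl

lemma expo_natCast_add_one (k : ℕ) (x : ℝ) : expo (k + 1) x = expo 1 x ^ (k + 1) := by
  rw [expo_eq, expo_eq, ← Complex.exp_nat_mul]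
  congr 1; push_cast; ring

lemma expo_eq_cos_add_sin (k : ℕ) (x : ℝ) :
    expo (k + 1) x = (Real.cos ((k + 1) * (2 * Real.pi * x)) : ℂ) +
      (Real.sin ((k + 1) * (2 * Real.pi * x)) : ℂ) * I := by
  rw [expo_eq, ofReal_cos, ofReal_sin, ← Complex.exp_mul_I]
  congr 1; push_cast; ring

lemma expo_neg_eq_cos_sub_sin (k : ℕ) (x : ℝ) :
    expo (-(k + 1)) x = (Real.cos ((k + 1) * (2 * Real.pi * x)) : ℂ) -
      (Real.sin ((k + 1) * (2 * Real.pi * x)) : ℂ) * I := by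
  have : (Real.cos ((k + 1) * (2 * Real.pi * x)) : ℂ) -
      (Real.sin ((k + 1) * (2 * Real.pi * x)) : ℂ) * I =
      Complex.cos (-((k + 1) * (2 * Real.pi * x))) +
      Complex.sin (-((k + 1) * (2 * Real.pi * x))) * I := by
    rw [Complex.cos_neg, Complex.sin_neg]; push_cast; ring
  rw [this, ← Complex.exp_mul_I, expo_eq]
  congr 1; push_cast; ring

lemma sin_pi_mul_pos {x : ℝ} (hx : x ∈ Ioo (0 : ℝ) 1) : 0 < Real.sin (Real.pi * x) :=
  Real.sin_pos_of_pos_of_lt_pi (mul_pos Real.pi_pos hx.1) (by nlinarith [Real.pi_pos, hx.2])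

lemma norm_one_sub_expo {x : ℝ} (hx : x ∈ Ioo (0 : ℝ) 1) :
    ‖1 - expo 1 x‖ = 2 * Real.sin (Real.pi * x) := by
  have hs := sin_pi_mul_pos hx
  have h := expo_eq_cos_add_sin 0 x
  simp only [Nat.cast_zero, zero_add, one_mul] at h
  have h2 : 2 * Real.pi * x = 2 * (Real.pi * x) := by ring
  rw [h, h2, ← sq_eq_sq₀ (norm_nonneg _) (by positivity), ← normSq_eq_norm_sq, normSq_apply]
  simp only [sub_re, one_re, add_re, ofReal_re, mul_re, I_re, mul_zero, ofReal_im, I_im, mul_one,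
    sub_self, add_zero, sub_im, one_im, add_im, mul_im, zero_add, zero_sub]
  rw [Real.cos_two_mul, Real.sin_two_mul]
  nlinarith [Real.sin_sq_add_cos_sq (Real.pi * x)]

lemma expo_one_ne_one {x : ℝ} (hx : x ∈ Ioo (0 : ℝ) 1) : expo 1 x ≠ 1 := by
  intro h
  have h2 := norm_one_sub_expo hx
  rw [h, sub_self, norm_zero] at h2
  linarith [sin_pi_mul_pos hx]

/-- The polylogarithm series converges on the unit circle away from `1`. -/
lemma exists_tendsto_polylog (l : ℕ) {x : ℝ} (hx : x ∈ Ioo (0 : ℝ) 1) :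
    ∃ L : ℂ, Tendsto (fun n => ∑ k ∈ Finset.range n, (1 / ((k : ℝ) + 1) ^ (l + 1)) • expo (k + 1) x)
      atTop (𝓝 L) := by
  -- Dirichlet's test: the geometric sums of `expo 1 x ≠ 1` are bounded by `2 / ‖expo 1 x - 1‖`.
  refine cauchySeq_tendsto_of_complete
    (Antitone.cauchySeq_series_mul_of_tendsto_zero_of_bounded (b := 2 / ‖expo 1 x - 1‖) ?_ ?_ ?_)
  · intro a b hab
    have : (a : ℝ) ≤ b := by exact_mod_cast hab
    dsimp only
    gcongr
  · refine squeeze_zero (fun n => by positivity) (fun n => ?_)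
      tendsto_one_div_add_atTop_nhds_zero_nat
    have h1 : (1 : ℝ) ≤ (n : ℝ) + 1 := by linarith [n.cast_nonneg (α := ℝ)]
    refine one_div_le_one_div_of_le (by positivity) (le_self_pow₀ h1 (by omega))
  · intro n
    have hz := expo_one_ne_one hx
    simp only [expo_natCast_add_one, pow_succ]
    rw [← Finset.sum_mul, geom_sum_eq hz, norm_mul, norm_expo, mul_one, norm_div]
    gcongr
    calc _ ≤ ‖expo 1 x ^ n‖ + ‖(1 : ℂ)‖ := norm_sub_le _ _
      _ = 2 := by rw [norm_pow, norm_expo]; norm_num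

lemma clausenTerm_eq_re_or_im (l : ℕ) (x : ℝ) (k : ℕ) :
    clausenTerm (l + 1) (2 * Real.pi * x) k =
      if Even (l + 1) then ((1 / ((k : ℝ) + 1) ^ (l + 1)) • expo (k + 1) x).im
      else ((1 / ((k : ℝ) + 1) ^ (l + 1)) • expo (k + 1) x).re := by
  rw [clausenTerm, expo_eq_cos_add_sin]
  simp only [smul_im, smul_re, add_im, add_re, mul_im, mul_re, ofReal_re, ofReal_im, I_re, I_im,
    smul_eq_mul]
  split_ifs <;> ring

lemma hasSum_clausen_of_tendsto {l : ℕ} {x : ℝ} {L : ℂ}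
    (h : Tendsto (fun n => ∑ k ∈ Finset.range n, (1 / ((k : ℝ) + 1) ^ (l + 1)) • expo (k + 1) x)
      atTop (𝓝 L)) :
    HasSum (clausenTerm (l + 1) (2 * Real.pi * x)) (if Even (l + 1) then L.im else L.re)
      (SummationFilter.conditional ℕ) := by
  rw [hasSum_conditional_iff]
  simp only [clausenTerm_eq_re_or_im]
  split_ifs
  · simpa only [im_sum, Function.comp_def] using (continuous_im.tendsto L).comp h
  · simpa only [re_sum, Function.comp_def] using (continuous_re.tendsto L).comp h

lemma summable_clausenTerm (l : ℕ) {x : ℝ} (hx : x ∈ Ioo (0 : ℝ) 1) :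
    Summable (clausenTerm (l + 1) (2 * Real.pi * x)) (SummationFilter.conditional ℕ) :=
  let ⟨_, h⟩ := exists_tendsto_polylog l hx
  (hasSum_clausen_of_tendsto h).summable

lemma tendsto_clausen (l : ℕ) {x : ℝ} (hx : x ∈ Ioo (0 : ℝ) 1) :
    Tendsto (fun n => ∑ k ∈ Finset.range n, clausenTerm (l + 1) (2 * Real.pi * x) k) atTop
      (𝓝 (clausen (l + 1) (2 * Real.pi * x))) :=
  hasSum_conditional_iff.1 (summable_clausenTerm l hx).hasSum

/-- Abel's limit theorem for the Taylor series of `-log (1 - z)` at the boundary point `z = expo 1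
x`, followed by real parts. -/
lemma clausen_one {x : ℝ} (hx : x ∈ Ioo (0 : ℝ) 1) :
    clausen 1 (2 * Real.pi * x) = -Real.log (2 * Real.sin (Real.pi * x)) := by
  obtain ⟨L, hL⟩ := exists_tendsto_polylog 0 hx
  have hcl : clausen 1 (2 * Real.pi * x) = L.re := by
    have := (hasSum_clausen_of_tendsto hL).tsum_eq
    simpa [clausen] using this
  have hAbel := tendsto_tsum_powerSeries_nhdsWithin_lt hL
  rw [tendsto_map'_iff] at hAbel
  have hslit : 1 - expo 1 x ∈ slitPlane := by
    refine Or.inl ?_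
    have h := expo_eq_cos_add_sin 0 x
    simp only [Nat.cast_zero, zero_add, one_mul] at h
    rw [h, show 2 * Real.pi * x = 2 * (Real.pi * x) by ring]
    simp only [sub_re, one_re, add_re, ofReal_re, mul_re, I_re, mul_zero, ofReal_im, I_im, mul_one,
      sub_self, add_zero]
    rw [Real.cos_two_mul]
    nlinarith [Real.sin_sq_add_cos_sq (Real.pi * x), pow_pos (sin_pi_mul_pos hx) 2]
  have hlog : Tendsto (fun r : ℝ => -Complex.log (1 - expo 1 x * r)) (𝓝[<] 1)
      (𝓝 (-Complex.log (1 - expo 1 x))) := by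
    have hc : ContinuousAt (fun r : ℝ => -Complex.log (1 - expo 1 x * r)) 1 := by
      refine ContinuousAt.neg (ContinuousAt.clog (by fun_prop) ?_)
      simpa using hslit
    simpa using hc.tendsto.mono_left nhdsWithin_le_nhds
  -- The extra factor `r` makes up for the index shift: it turns `z ^ (n + 1) r ^ n / (n + 1)` into
  -- a term of the series of `-log (1 - z r)`.
  have hmul : Tendsto (fun r : ℝ => (r : ℂ) *
      ∑' n : ℕ, ((1 / ((n : ℝ) + 1) ^ (0 + 1)) • expo (n + 1) x) * (r : ℂ) ^ n) (𝓝[<] 1)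
      (𝓝 (((1 : ℝ) : ℂ) * L)) :=
    ((continuous_ofReal.tendsto 1).mono_left nhdsWithin_le_nhds).mul hAbel
  have heq : ∀ᶠ r : ℝ in 𝓝[<] 1, (r : ℂ) *
      ∑' n : ℕ, ((1 / ((n : ℝ) + 1) ^ (0 + 1)) • expo (n + 1) x) * (r : ℂ) ^ n =
      -Complex.log (1 - expo 1 x * r) := by
    filter_upwards [Ioo_mem_nhdsLT (show (-1 : ℝ) < 1 by norm_num)] with r hr
    have hn : ‖expo 1 x * r‖ < 1 := by
      rw [norm_mul, norm_expo, one_mul, norm_real, Real.norm_eq_abs, abs_lt]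
      exact hr
    have h := (hasSum_nat_add_iff' 1).2 (hasSum_taylorSeries_neg_log hn)
    simp only [Finset.range_one, Finset.sum_singleton, Nat.cast_zero, div_zero, sub_zero] at h
    rw [← h.tsum_eq, ← tsum_mul_left]
    refine tsum_congr fun n => ?_
    rw [expo_natCast_add_one, real_smul]
    push_cast
    ring
  have hfin := tendsto_nhds_unique (hmul.congr' heq) hlog
  rw [ofReal_one, one_mul] at hfin
  rw [hcl, hfin, neg_re, log_re, norm_one_sub_expo hx]

lemma clausen_one_sub (l : ℕ) {x : ℝ} (hx : x ∈ Ioo (0 : ℝ) 1) :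
    clausen (l + 1) (2 * Real.pi * (1 - x)) = (-1) ^ l * clausen (l + 1) (2 * Real.pi * x) := by
  have hx' : 1 - x ∈ Ioo (0 : ℝ) 1 := ⟨by linarith [hx.2], by linarith [hx.1]⟩
  refine tendsto_nhds_unique (tendsto_clausen l hx') (((tendsto_clausen l hx).const_mul _).congr
    fun n => ?_)
  rw [Finset.mul_sum]
  refine Finset.sum_congr rfl fun k _ => ?_
  have harg : ((k : ℝ) + 1) * (2 * Real.pi * (1 - x)) =
      ((k + 1 : ℕ) : ℝ) * (2 * Real.pi) - (k + 1) * (2 * Real.pi * x) := by push_cast; ring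
  rw [clausenTerm, clausenTerm, harg, Real.sin_nat_mul_two_pi_sub, Real.cos_nat_mul_two_pi_sub]
  rcases Nat.even_or_odd l with h | h
  · rw [if_neg (by simpa [Nat.even_add_one] using h), if_neg (by simpa [Nat.even_add_one] using h),
      h.neg_one_pow, one_mul]
  · rw [if_pos h.add_one, if_pos h.add_one, h.neg_one_pow]
    ring

/-- The Clausen function of order `l + 1`, normalised so that its Fourier coefficients are
`sign k / k ^ (l + 1)`. -/
def clausenNorm (l : ℕ) (x : ℝ) : ℂ :=
  2 * I ^ l * (-1) ^ (l / 2) * (clausen (l + 1) (2 * Real.pi * x) : ℂ)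

/-- Even `l` is the cosine case, `e_k + e_{-k} = 2 cos`; odd `l` is the sine case, `e_k - e_{-k} =
2i sin`. -/
lemma I_pow_mul_neg_one_pow_half (l : ℕ) : I ^ l * (-1) ^ (l / 2) = if Even l then 1 else I := by
  split_ifs with h
  · obtain ⟨r, rfl⟩ := h
    rw [← two_mul, pow_mul, I_sq, Nat.mul_div_cancel_left r two_pos, ← mul_pow]
    simp
  · obtain ⟨r, rfl⟩ := Nat.not_even_iff_odd.1 h
    rw [show (2 * r + 1) / 2 = r by omega, pow_succ, pow_mul, I_sq, mul_right_comm, ← mul_pow]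
    simp

lemma memLp_and_coeff_clausenNorm (l : ℕ) :
    MemLp (clausenNorm l) 2 unitMeasure ∧
      ∀ k : ℤ, coeff (clausenNorm l) k = (k.sign : ℂ) / (k : ℂ) ^ (l + 1) := by
  refine memLp_and_coeff_of_tendsto (a := fun k : ℤ => (k.sign : ℂ) / (k : ℂ) ^ (l + 1)) ?_
    (by simp) fun x hx => ?_
  · refine Summable.of_nonneg_of_le (fun k => by positivity) (fun k => ?_)
      (Real.summable_one_div_int_pow.2 (one_lt_two))
    rcases eq_or_ne k 0 with rfl | hk
    · simp
    have h1 : (1 : ℝ) ≤ |(k : ℝ)| := by exact_mod_cast Int.one_le_abs hk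
    have hs : ‖(k.sign : ℂ)‖ = 1 := by
      rcases lt_or_gt_of_ne hk with h | h
      · simp [Int.sign_eq_neg_one_of_neg h]
      · simp [Int.sign_eq_one_of_pos h]
    rw [norm_div, hs, norm_pow, Complex.norm_intCast, div_pow, one_pow, ← sq_abs (k : ℝ)]
    have : |(k : ℝ)| ≤ |(k : ℝ)| ^ (l + 1) := le_self_pow₀ h1 (by omega)
    gcongr
  · have h := ((continuous_ofReal.tendsto _).comp (tendsto_clausen l hx)).const_mul
      (2 * I ^ l * (-1) ^ (l / 2))
    refine h.congr fun n => ?_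
    rw [Function.comp_apply, ofReal_sum, Finset.mul_sum]
    refine Finset.sum_congr rfl fun k _ => ?_
    have hp : ((k : ℤ) + 1).sign = 1 := Int.sign_eq_one_of_pos (by positivity)
    rw [Int.sign_neg, hp, expo_eq_cos_add_sin, expo_neg_eq_cos_sub_sin, mul_assoc 2,
      I_pow_mul_neg_one_pow_half, clausenTerm]
    have hk : (k : ℂ) + 1 ≠ 0 := Nat.cast_add_one_ne_zero k
    rcases Nat.even_or_odd l with hl | hl
    · rw [if_pos hl, if_neg (by simpa [Nat.even_add_one] using hl)]
      push_cast
      rw [(hl.add_one).neg_pow]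
      field_simp
      ring
    · rw [if_neg (Nat.not_even_iff_odd.2 hl), if_pos hl.add_one]
      push_cast
      rw [(hl.add_one).neg_pow]
      field_simp
      ring

lemma clausenNorm_one_sub (l : ℕ) {x : ℝ} (hx : x ∈ Ioo (0 : ℝ) 1) :
    clausenNorm l (1 - x) = (-1) ^ l * clausenNorm l x := by
  rw [clausenNorm, clausen_one_sub l hx, clausenNorm]
  push_cast; ring

/-! ### Bernoulli polynomials -/

/-- The Bernoulli polynomial of degree `j`, normalised so that its Fourier coefficients are
`-1 / k ^ j` for `j ≠ 0`. -/
def bernoulliNorm (j : ℕ) (x : ℝ) : ℂ :=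
  (2 * Real.pi * I) ^ j / (j.factorial : ℂ) * (bernoulliFun j x : ℂ)

lemma continuous_bernoulliNorm (j : ℕ) : Continuous (bernoulliNorm j) :=
  continuous_const.mul (continuous_ofReal.comp (continuous_bernoulliFun j))

lemma bernoulliNorm_one_sub (j : ℕ) (x : ℝ) :
    bernoulliNorm j (1 - x) = (-1) ^ j * bernoulliNorm j x := by
  rw [bernoulliNorm, bernoulliFun_eval_one_sub, bernoulliNorm]
  push_cast; ring

lemma exists_norm_bernoulliNorm_le (j : ℕ) :
    ∃ C, ∀ᵐ x ∂unitMeasure, ‖bernoulliNorm j x‖ ≤ C := by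
  obtain ⟨C, hC⟩ := isCompact_Icc (a := (0 : ℝ)) (b := 1) |>.exists_bound_of_continuousOn
    (continuous_bernoulliNorm j).continuousOn
  exact ⟨C, ae_unit_of_Ioo fun x hx => hC x (Ioo_subset_Icc_self hx)⟩

lemma memLp_bernoulliNorm (j : ℕ) : MemLp (bernoulliNorm j) 2 unitMeasure :=
  let ⟨C, hC⟩ := exists_norm_bernoulliNorm_le j
  MemLp.of_bound (continuous_bernoulliNorm j).aestronglyMeasurable C hC

lemma coeff_bernoulliFun (j : ℕ) (k : ℤ) :
    coeff (fun x => (bernoulliFun j x : ℂ)) k = bernoulliFourierCoeff j k := by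
  rw [bernoulliFourierCoeff, fourierCoeffOn_eq_integral, coeff]
  simp only [fourier_coe_apply, expo_eq, sub_zero, div_one, one_smul, smul_eq_mul, ofReal_one]

lemma coeff_bernoulliNorm {j : ℕ} (hj : j ≠ 0) (k : ℤ) :
    coeff (bernoulliNorm j) k = -1 / (k : ℂ) ^ j := by
  have : coeff (bernoulliNorm j) k = (2 * Real.pi * I) ^ j / (j.factorial : ℂ) *
      coeff (fun x => (bernoulliFun j x : ℂ)) k := by
    rw [coeff, coeff, ← intervalIntegral.integral_const_mul]
    refine intervalIntegral.integral_congr fun x _ => ?_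
    simp only [bernoulliNorm]; ring
  rw [this, coeff_bernoulliFun, bernoulliFourierCoeff_eq hj]
  have h1 : (j.factorial : ℂ) ≠ 0 := by exact_mod_cast j.factorial_ne_zero
  have h2 : (2 * Real.pi * I : ℂ) ^ j ≠ 0 := pow_ne_zero _ two_pi_I_ne_zero
  rw [mul_pow _ (k : ℂ)]
  rcases eq_or_ne ((k : ℂ) ^ j) 0 with h | h
  · simp [h]
  · field_simp

lemma coeff_bernoulliNorm_zero (k : ℤ) :
    coeff (bernoulliNorm 0) k = if k = 0 then 1 else 0 := by
  have : coeff (bernoulliNorm 0) k = coeff (fun x => (bernoulliFun 0 x : ℂ)) k := by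
    congr 1; funext x; simp [bernoulliNorm]
  split_ifs with h
  · subst h
    rw [this, coeff_zero_index]; simp
  · rw [this, coeff_bernoulliFun, bernoulli_zero_fourier_coeff h]

/-! ### Partial fractions -/

/-- One half of the partial fraction expansion of `u ^ a * v ^ b`, where `u * v = w * (u + v)`. -/
def fracSum (u w : ℂ) (a b : ℕ) : ℂ :=
  ∑ t ∈ Finset.range a, ((b + t - 1).choose t : ℂ) * (u ^ (a - t) * w ^ (b + t))

lemma fracSum_zero_right (u w : ℂ) (a : ℕ) : fracSum u w (a + 1) 0 = u ^ (a + 1) := by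
  rw [fracSum, Finset.sum_range_succ', Finset.sum_eq_zero]
  · simp
  · intro t _
    rw [Nat.choose_eq_zero_of_lt (by omega)]; simp

/-- Pascal's rule for the coefficients. It mirrors one application of `u v = w (u + v)`, which is
what drives the induction for the expansion. -/
lemma fracSum_succ (u w : ℂ) (a b : ℕ) :
    fracSum u w (a + 1) (b + 1) = w * (fracSum u w a (b + 1) + fracSum u w (a + 1) b) := by
  simp only [fracSum]
  rw [Finset.sum_range_succ', Finset.sum_range_succ' (n := a) (f := fun t =>
    ((b + t - 1).choose t : ℂ) * (u ^ (a + 1 - t) * w ^ (b + t))), ← add_assoc,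
    ← Finset.sum_add_distrib, mul_add, Finset.mul_sum]
  congr 1
  · refine Finset.sum_congr rfl fun t _ => ?_
    have h1 : b + 1 + (t + 1) - 1 = (b + t) + 1 := by omega
    have h2 : b + 1 + t - 1 = b + t := by omega
    have h3 : b + (t + 1) - 1 = b + t := by omega
    have h4 : a + 1 - (t + 1) = a - t := by omega
    rw [h1, h2, h3, h4, Nat.choose_succ_succ]
    push_cast
    ring
  · simp; ring

/-- The partial fraction expansion of `1 / (x ^ a * y ^ b)`, in terms of `u = 1 / x`, `v = 1 / y`
and `w = 1 / (x + y)`. -/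
lemma pow_mul_pow_eq_fracSum {u v w : ℂ} (h : u * v = w * (u + v)) :
    ∀ a b : ℕ, 0 < a + b → u ^ a * v ^ b = fracSum u w a b + fracSum v w b a := by
  intro a
  induction a with
  | zero =>
    intro b hb
    obtain ⟨b, rfl⟩ : ∃ c, b = c + 1 := ⟨b - 1, by omega⟩
    rw [fracSum_zero_right]; simp [fracSum]
  | succ a iha =>
    intro b
    induction b with
    | zero => intro _; rw [fracSum_zero_right]; simp [fracSum]
    | succ b ihb =>
      intro _
      rw [fracSum_succ, fracSum_succ]
      have h1 := iha (b + 1) (by omega)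
      have h2 := ihb (by omega)
      calc u ^ (a + 1) * v ^ (b + 1) = (u * v) * (u ^ a * v ^ b) := by ring
        _ = w * (u ^ a * v ^ (b + 1) + u ^ (a + 1) * v ^ b) := by rw [h]; ring
        _ = _ := by rw [h1, h2]; ring

lemma sum_choose_add_sub_one {m : ℕ} (hm : 0 < m) (ν : ℕ) :
    ∑ s ∈ Finset.range (ν + 1), (m + s - 1).choose s = (ν + m).choose m := by
  induction ν with
  | zero => simp
  | succ ν ih =>
    rw [Finset.sum_range_succ, ih]
    have h1 : m + (ν + 1) - 1 = ν + m := by omega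
    have h2 : ν + 1 + m = (ν + m) + 1 := by omega
    obtain ⟨m, rfl⟩ : ∃ c, m = c + 1 := ⟨m - 1, by omega⟩
    rw [h1, h2, Nat.choose_succ_succ (ν + (m + 1)) m, add_comm]
    congr 1
    exact Nat.choose_symm_of_eq_add (by omega)

/-- The convolution of the coefficients of the normalised Bernoulli and Clausen functions,
weighted by binomial coefficients, in partial fractions. -/
lemma sum_convolution_eq {m : ℕ} (hm : 0 < m) (ν : ℕ) {p : ℤ} (hp : p ≠ 0) (k : ℤ) :
    (k.sign : ℂ) * ((if p - k = 0 then ((ν + m).choose m : ℂ) / (k : ℂ) ^ (ν + m + 1) else 0) -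
        fracSum (1 / ((k : ℂ) - p)) (1 / (k : ℂ)) m (ν + 1)) =
      -((k.sign : ℂ) / ((k : ℂ) - p) ^ m) * (1 / (p : ℂ) ^ (ν + 1)) +
        ∑ s ∈ Finset.range (ν + 1), ((m + s - 1).choose s : ℂ) * (1 / (p : ℂ) ^ (ν + 1 - s)) *
          ((k.sign : ℂ) / (k : ℂ) ^ (m + s)) := by
  rcases eq_or_ne k 0 with rfl | hk
  · simp
  have hpc : (p : ℂ) ≠ 0 := by exact_mod_cast hp
  have hkc : (k : ℂ) ≠ 0 := by exact_mod_cast hk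
  have hsum : ∑ s ∈ Finset.range (ν + 1), ((m + s - 1).choose s : ℂ) *
      (1 / (p : ℂ) ^ (ν + 1 - s)) * ((k.sign : ℂ) / (k : ℂ) ^ (m + s)) =
      (k.sign : ℂ) * fracSum (1 / (p : ℂ)) (1 / (k : ℂ)) (ν + 1) m := by
    rw [fracSum, Finset.mul_sum]
    refine Finset.sum_congr rfl fun s _ => ?_
    rw [one_div_pow, one_div_pow]; ring
  rw [hsum]
  rcases eq_or_ne p k with rfl | hpk
  -- At `k = p` the inverse of `k - p` is `0` by convention, so the expansion is not available. The
  -- right side instead reduces to powers of `1 / p`, and the hockey-stick sum of their binomials is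
  -- the indicator term.
  · rw [if_pos (sub_self p), sub_self, zero_pow hm.ne', div_zero, div_zero]
    have h1 : fracSum 0 (1 / (p : ℂ)) m (ν + 1) = 0 := by
      refine Finset.sum_eq_zero fun t ht => ?_
      rw [zero_pow (by have := Finset.mem_range.1 ht; omega)]; ring
    have h2 : fracSum (1 / (p : ℂ)) (1 / (p : ℂ)) (ν + 1) m =
        ((ν + m).choose m : ℂ) / (p : ℂ) ^ (ν + m + 1) := by
      rw [← sum_choose_add_sub_one hm ν, fracSum]
      push_cast
      rw [Finset.sum_div]
      refine Finset.sum_congr rfl fun s hs => ?_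
      have := Finset.mem_range.1 hs
      rw [← pow_add, one_div_pow, show ν + 1 - s + (m + s) = ν + m + 1 by omega]; ring
    rw [h1, h2]; ring
  · have hne : (k : ℂ) - p ≠ 0 := sub_ne_zero.2 (by exact_mod_cast hpk.symm)
    rw [if_neg (sub_ne_zero.2 hpk)]
    have h := pow_mul_pow_eq_fracSum (u := 1 / ((k : ℂ) - p)) (v := 1 / (p : ℂ))
      (w := 1 / (k : ℂ)) (by field_simp; ring) m (ν + 1) (by omega)
    rw [one_div_pow, one_div_pow] at h
    linear_combination (k.sign : ℂ) * h

/-! ### Zeta sums -/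

lemma hasSum_zeta {a : ℕ} (ha : 2 ≤ a) :
    HasSum (fun k : ℕ => 1 / ((k : ℂ) + 1) ^ a) (riemannZeta (a : ℂ)) := by
  have hs : Summable (fun k : ℕ => 1 / ((k : ℂ) + 1) ^ a) := by
    have h := (summable_nat_add_iff 1).2 (Real.summable_one_div_nat_pow.2 (show 1 < a by omega))
    have h2 := (ofRealCLM.summable h)
    refine h2.congr fun k => ?_
    simp
  have := hs.hasSum
  rwa [show ∑' k : ℕ, 1 / ((k : ℂ) + 1) ^ a = riemannZeta (a : ℂ) by
    rw [zeta_eq_tsum_one_div_nat_add_one_cpow (by simp; omega)]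
    simp] at this

/-- The generalised harmonic number `∑_{i < q} 1 / (i + 1) ^ m`. -/
def harm (m q : ℕ) : ℂ := ∑ i ∈ Finset.range q, 1 / ((i : ℂ) + 1) ^ m

lemma hasSum_sign_div_pow {a : ℕ} (ha : 2 ≤ a) :
    HasSum (fun k : ℤ => (k.sign : ℂ) / (k : ℂ) ^ a) ((1 - (-1) ^ a) * riemannZeta (a : ℂ)) := by
  have h1 := hasSum_zeta ha
  have h := HasSum.of_add_one_of_neg_add_one (f := fun k : ℤ => (k.sign : ℂ) / (k : ℂ) ^ a)
    (m := riemannZeta (a : ℂ)) (m' := -(-1) ^ a * riemannZeta (a : ℂ)) ?_ ?_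
  · convert! h using 1
    simp; ring
  · convert! h1 using 2 with k
    rw [Int.sign_eq_one_of_pos (by positivity)]; push_cast; ring
  · convert! h1.mul_left (-(-1 : ℂ) ^ a) using 2 with k
    rw [Int.sign_eq_neg_one_of_neg (by omega)]
    push_cast
    rw [show -((k : ℂ) + 1) = -1 * (k + 1) by ring, mul_pow]
    rcases Nat.even_or_odd a with h | h <;> simp [h.neg_one_pow]; ring

/-- The sign is `-1` beyond `q`, so the sum is `-z` corrected by `2 g` below `q` and by `g` at `q`.
-/
lemma hasSum_sign_sub_mul {g : ℕ → ℂ} {z : ℂ} (hg : HasSum g z) (q : ℕ) :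
    HasSum (fun n : ℕ => ((((q : ℤ) - n).sign : ℤ) : ℂ) * g n)
      (-z + (2 * ∑ i ∈ Finset.range q, g i + g q)) := by
  have hfin : HasSum (fun n : ℕ => if n < q then 2 * g n else if n = q then g n else 0)
      (∑ n ∈ Finset.range (q + 1), if n < q then 2 * g n else if n = q then g n else 0) :=
    hasSum_sum_of_ne_finset_zero fun n hn => by
      have : ¬ n < q + 1 := fun h => hn (Finset.mem_range.2 h)
      rw [if_neg (by omega), if_neg (by omega)]
  have hval : (∑ n ∈ Finset.range (q + 1), if n < q then 2 * g n else if n = q then g n else 0) =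
      2 * ∑ i ∈ Finset.range q, g i + g q := by
    rw [Finset.sum_range_succ, Finset.mul_sum]
    congr 1
    · refine Finset.sum_congr rfl fun n hn => ?_
      rw [if_pos (Finset.mem_range.1 hn)]
    · simp
  rw [hval] at hfin
  convert! hg.neg.add hfin using 2 with n
  rcases lt_trichotomy n q with h | h | h
  · rw [if_pos h, Int.sign_eq_one_of_pos (by omega)]; push_cast; ring
  · subst h; simp
  · rw [if_neg (by omega), if_neg (by omega), Int.sign_eq_neg_one_of_neg (by omega)]
    push_cast; ring

/-- The source of the harmonic numbers. After centring at the pole `q + 1`, where the term is `0` by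
convention, the sign jumps at `-(q + 1)`, and the indices between the jump and the pole contribute
`harm m q`. -/
lemma hasSum_sign_div_sub_pow {m : ℕ} (hm : 2 ≤ m) (q : ℕ) :
    HasSum (fun k : ℤ => (k.sign : ℂ) / ((k : ℂ) - ((q + 1 : ℕ) : ℤ)) ^ m)
      ((1 - (-1) ^ m) * riemannZeta (m : ℂ) +
        (-1) ^ m * (2 * harm m q + 1 / ((q : ℂ) + 1) ^ m)) := by
  rw [← (Equiv.addRight ((q + 1 : ℕ) : ℤ)).hasSum_iff]
  have h1 := hasSum_zeta hm
  have h := HasSum.of_add_one_of_neg_add_one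
    (f := (fun k : ℤ => (k.sign : ℂ) / ((k : ℂ) - ((q + 1 : ℕ) : ℤ)) ^ m) ∘
      (Equiv.addRight ((q + 1 : ℕ) : ℤ)))
    (m := riemannZeta (m : ℂ))
    (m' := (-1) ^ m * (-riemannZeta (m : ℂ) + (2 * harm m q + 1 / ((q : ℂ) + 1) ^ m))) ?_ ?_
  · convert! h using 1
    simp [show m ≠ 0 by omega]; ring
  · convert! h1 using 2 with k
    simp only [Function.comp_apply, Equiv.coe_addRight]
    rw [Int.sign_eq_one_of_pos (by positivity)]; push_cast; ring
  · convert! (hasSum_sign_sub_mul h1 q).mul_left ((-1 : ℂ) ^ m) using 2 with k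
    simp only [Function.comp_apply, Equiv.coe_addRight]
    rw [show -((k : ℤ) + 1) + ((q + 1 : ℕ) : ℤ) = (q : ℤ) - k by push_cast; ring]
    push_cast
    rw [show (q : ℂ) - k - (q + 1) = -1 * (k + 1) by ring, mul_pow]
    rcases Nat.even_or_odd m with h | h <;> simp [h.neg_one_pow] <;> ring

/-! ### The Tornheim series -/

lemma summable_term {m n : ℕ} (hm : 2 ≤ m) (hn : 2 ≤ n) :
    Summable (fun p : ℕ × ℕ => term m 0 n p.1 p.2) := by
  have h : Summable fun k : ℕ => 1 / ((k : ℝ) + 1) ^ 2 := by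
    have := (summable_nat_add_iff 1).2 (Real.summable_one_div_nat_pow.2 (one_lt_two))
    simpa using this
  refine Summable.of_nonneg_of_le (fun p => ?_) (fun p => ?_)
    (h.mul_of_nonneg h (fun k => by positivity) (fun k => by positivity))
  · unfold term; positivity
  · obtain ⟨r, s⟩ := p
    simp only [term, pow_zero, mul_one]
    rw [one_div_mul_one_div]
    have hr : (0 : ℝ) ≤ r := r.cast_nonneg
    have hs : (0 : ℝ) ≤ s := s.cast_nonneg
    have h1 : ((r : ℝ) + 1) ^ 2 ≤ (r + 1) ^ m := pow_le_pow_right₀ (by linarith) hm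
    have h2 : ((s : ℝ) + 1) ^ 2 ≤ (r + 1 + (s + 1)) ^ n :=
      calc ((s : ℝ) + 1) ^ 2 ≤ (r + 1 + (s + 1)) ^ 2 :=
          pow_le_pow_left₀ (by linarith) (by linarith) 2
        _ ≤ _ := pow_le_pow_right₀ (by linarith) hn
    gcongr

lemma hasSum_harm_div_pow {m n : ℕ} (hm : 2 ≤ m) (hn : 2 ≤ n) :
    HasSum (fun q : ℕ => harm m q * (1 / ((q : ℂ) + 1) ^ n)) (T m 0 n : ℂ) := by
  have hs := summable_term hm hn
  have h1 : HasSum (fun p : ℕ × ℕ => term m 0 n p.1 p.2) (T m 0 n) := by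
    have h := hs.hasSum
    rwa [hs.tsum_prod] at h
  -- Group by `d = r + s`; with both indices shifted by one, the denominator `r + s` of the series
  -- is `d + 2`.
  rw [← Finset.HasAntidiagonal.sigmaAntidiagonalEquivProd.hasSum_iff] at h1
  have h2 := h1.sigma (g := fun d => ∑ i ∈ Finset.range (d + 1),
    1 / ((i : ℝ) + 1) ^ m * (1 / ((d : ℝ) + 2) ^ n)) fun d => by
    have := hasSum_fintype (fun c : Finset.HasAntidiagonal.antidiagonal d =>
      ((fun p : ℕ × ℕ => term m 0 n p.1 p.2) ∘ Finset.HasAntidiagonal.sigmaAntidiagonalEquivProd) ⟨d, c⟩)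
    convert! this using 1
    simp only [Function.comp_apply, Finset.HasAntidiagonal.sigmaAntidiagonalEquivProd_apply]
    rw [Finset.sum_coe_sort (Finset.HasAntidiagonal.antidiagonal d) (fun p : ℕ × ℕ => term m 0 n p.1 p.2),
      Finset.Nat.sum_antidiagonal_eq_sum_range_succ_mk]
    refine Finset.sum_congr rfl fun i hi => ?_
    have hid : i ≤ d := by have := Finset.mem_range.1 hi; omega
    simp only [term, pow_zero, mul_one]
    rw [one_div_mul_one_div, Nat.cast_sub hid]
    congr 3; ring
  have h3 := hasSum_ofReal.2 h2
  rw [← hasSum_nat_add_iff' 1]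
  simp only [Finset.range_one, Finset.sum_singleton, harm, Finset.range_zero, Finset.sum_empty,
    zero_mul, sub_zero]
  convert! h3 using 2 with d
  rw [Finset.sum_mul]
  push_cast
  refine Finset.sum_congr rfl fun i _ => ?_
  congr 3; ring

/-- The square of index pairs splits into two open triangles and the diagonal. The splitting is
already exact for partial sums. -/
lemma T_add_T_swap {m n : ℕ} (hm : 2 ≤ m) (hn : 2 ≤ n) :
    (T m 0 n : ℂ) + T n 0 m + riemannZeta ((m + n : ℕ) : ℂ) =
      riemannZeta (m : ℂ) * riemannZeta (n : ℂ) := by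
  have h := (((hasSum_harm_div_pow hm hn).add (hasSum_harm_div_pow hn hm)).add
    (hasSum_zeta (show 2 ≤ m + n by omega))).tendsto_sum_nat
  refine tendsto_nhds_unique h (((hasSum_zeta hm).tendsto_sum_nat.mul
    (hasSum_zeta hn).tendsto_sum_nat).congr fun K => ?_)
  change harm m K * harm n K = _
  induction K with
  | zero => simp [harm]
  | succ K ih =>
    rw [Finset.sum_range_succ, ← ih]
    have e : ∀ a, harm a (K + 1) = harm a K + 1 / ((K : ℂ) + 1) ^ a := fun a => by
      rw [harm, Finset.sum_range_succ]; rfl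
    rw [e, e, pow_add]
    ring

/-! ### The logarithm of the Gamma function -/

lemma one_sub_mem_Ioo {x : ℝ} (hx : x ∈ Ioo (0 : ℝ) 1) : 1 - x ∈ Ioo (0 : ℝ) 1 :=
  ⟨by linarith [hx.2], by linarith [hx.1]⟩

lemma log_Gamma_add_log_Gamma_one_sub {x : ℝ} (hx : x ∈ Ioo (0 : ℝ) 1) :
    Real.log (Real.Gamma x) + Real.log (Real.Gamma (1 - x)) =
      Real.log (2 * Real.pi) + clausen 1 (2 * Real.pi * x) := by
  have hs := sin_pi_mul_pos hx
  have h1 := Real.Gamma_pos_of_pos hx.1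
  have h2 := Real.Gamma_pos_of_pos (one_sub_mem_Ioo hx).1
  rw [clausen_one hx, ← Real.log_mul h1.ne' h2.ne', Real.Gamma_mul_Gamma_one_sub,
    Real.log_div Real.pi_pos.ne' hs.ne', Real.log_mul two_ne_zero Real.pi_pos.ne',
    Real.log_mul two_ne_zero hs.ne']
  ring

/-- `log Γ` is convex and vanishes at `1` and `2`; the point `1` lies between `x` and `2`. -/
lemma log_Gamma_nonneg {x : ℝ} (hx : x ∈ Ioo (0 : ℝ) 1) : 0 ≤ Real.log (Real.Gamma x) := by
  have hx2 := hx.2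
  have hx' : 0 < 2 - x := by linarith
  have hconv := Real.convexOn_log_Gamma
  have h := hconv.2 (mem_Ioi.2 hx.1) (mem_Ioi.2 (zero_lt_two' ℝ))
    (div_nonneg zero_le_one hx'.le) (div_nonneg (sub_nonneg.2 hx2.le) hx'.le)
    (show 1 / (2 - x) + (1 - x) / (2 - x) = 1 by
      rw [← add_div]; exact (div_eq_one_iff_eq hx'.ne').2 (by ring))
  have hone : 1 / (2 - x) * x + (1 - x) / (2 - x) * 2 = 1 := by field_simp; ring
  simp only [smul_eq_mul, hone, Function.comp_apply, Real.Gamma_one, Real.log_one,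
    Real.Gamma_two, mul_zero, add_zero] at h
  exact nonneg_of_mul_nonneg_right h (div_pos one_pos hx')

lemma clausenNorm_zero (x : ℝ) : clausenNorm 0 x = 2 * (clausen 1 (2 * Real.pi * x) : ℂ) := by
  simp [clausenNorm]

/-- Both summands in the reflection formula are nonnegative, so `log Γ(x)` is dominated by `log 2π +
Cl_1(2πx)`, which is square integrable. -/
lemma memLp_log_Gamma : MemLp (fun x => (Real.log (Real.Gamma x) : ℂ)) 2 unitMeasure := by
  have hg : MemLp (fun x => (Real.log (2 * Real.pi) : ℂ) + 1 / 2 * clausenNorm 0 x) 2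
      unitMeasure := by
    have h1 : MemLp (fun _ : ℝ => (Real.log (2 * Real.pi) : ℂ)) 2 unitMeasure := memLp_const _
    have h2 : MemLp (fun x => 1 / 2 * clausenNorm 0 x) 2 unitMeasure :=
      (memLp_and_coeff_clausenNorm 0).1.const_mul _
    exact h1.add h2
  refine hg.of_le ?_ (ae_unit_of_Ioo fun x hx => ?_)
  · rw [unitMeasure, ← restrict_Ioo_eq_restrict_Ioc]
    refine ContinuousOn.aestronglyMeasurable (fun x hx => ?_) measurableSet_Ioo
    refine ContinuousAt.continuousWithinAt (continuous_ofReal.continuousAt.comp ?_)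
    refine ContinuousAt.log ?_ (Real.Gamma_pos_of_pos hx.1).ne'
    refine (Real.differentiableAt_Gamma fun m => ?_).continuousAt
    have h1 := hx.1
    have h2 : (0 : ℝ) ≤ m := m.cast_nonneg
    linarith
  · have h : (Real.log (2 * Real.pi) : ℂ) + 1 / 2 * clausenNorm 0 x =
        ((Real.log (Real.Gamma x) + Real.log (Real.Gamma (1 - x)) : ℝ) : ℂ) := by
      rw [log_Gamma_add_log_Gamma_one_sub hx, clausenNorm_zero]; push_cast; ring
    have h1 := log_Gamma_nonneg hx
    have h2 := log_Gamma_nonneg (one_sub_mem_Ioo hx)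
    rw [h, norm_real, norm_real, Real.norm_of_nonneg h1, Real.norm_of_nonneg (add_nonneg h1 h2)]
    linarith

lemma intervalIntegrable_mul {f g : ℝ → ℂ} (hf : MemLp f 2 unitMeasure)
    (hg : MemLp g 2 unitMeasure) : IntervalIntegrable (fun x => f x * g x) volume 0 1 := by
  rw [intervalIntegrable_iff_integrableOn_Ioc_of_le zero_le_one]
  exact hf.integrable_mul hg

lemma intervalIntegrable_of_memLp {f : ℝ → ℂ} (hf : MemLp f 2 unitMeasure) :
    IntervalIntegrable f volume 0 1 := by
  simpa using intervalIntegrable_mul (memLp_const 1) hf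

lemma integral_comp_one_sub (f : ℝ → ℂ) :
    ∫ x in (0 : ℝ)..1, f (1 - x) = ∫ x in (0 : ℝ)..1, f x := by
  rw [intervalIntegral.integral_comp_sub_left (fun x => f x) 1]; simp

/-- Against a function symmetric under `x ↦ 1 - x`, the logarithm of the Gamma function can be
replaced by the average that the reflection formula evaluates. -/
lemma two_mul_integral_log_Gamma_mul {G : ℝ → ℂ} (hG : MemLp G 2 unitMeasure)
    (hsymm : ∀ x ∈ Ioo (0 : ℝ) 1, G (1 - x) = G x) :
    2 * ∫ x in (0 : ℝ)..1, (Real.log (Real.Gamma x) : ℂ) * G x =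
      Real.log (2 * Real.pi) * coeff G 0 + 1 / 2 * coeff (fun x => clausenNorm 0 x * G x) 0 := by
  have hint := intervalIntegrable_mul memLp_log_Gamma hG
  have hrefl := (hint.comp_sub_left 1).symm
  simp only [sub_self, sub_zero] at hrefl
  have h1 := integral_comp_one_sub (fun x => (Real.log (Real.Gamma x) : ℂ) * G x)
  rw [two_mul]
  nth_rewrite 1 [← h1]
  rw [← intervalIntegral.integral_add hrefl hint, coeff_zero_index, coeff_zero_index,
    ← intervalIntegral.integral_const_mul, ← intervalIntegral.integral_const_mul,
    ← intervalIntegral.integral_add ((intervalIntegrable_of_memLp hG).const_mul _)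
      ((intervalIntegrable_mul (memLp_and_coeff_clausenNorm 0).1 hG).const_mul _)]
  refine intervalIntegral.integral_congr_Ioo_of_le zero_le_one fun x hx => ?_
  have h : ((Real.log (Real.Gamma x) + Real.log (Real.Gamma (1 - x)) : ℝ) : ℂ) = _ :=
    congrArg _ (log_Gamma_add_log_Gamma_one_sub hx)
  push_cast at h
  simp only [hsymm x hx, clausenNorm_zero]
  linear_combination G x * h

lemma memLp_bernoulliNorm_mul_clausenNorm (j l : ℕ) :
    MemLp (fun x => bernoulliNorm j x * clausenNorm l x) 2 unitMeasure := by
  obtain ⟨C, hC⟩ := exists_norm_bernoulliNorm_le j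
  have hV := (memLp_and_coeff_clausenNorm l).1
  refine hV.of_le_mul (c := C)
    ((continuous_bernoulliNorm j).aestronglyMeasurable.mul hV.aestronglyMeasurable) ?_
  filter_upwards [hC] with x hx
  rw [norm_mul]
  gcongr

lemma ofReal_integrand (j l : ℕ) (x : ℝ) :
    (integrand j l x : ℂ) = (j.factorial : ℂ) / ((2 * Real.pi * I) ^ j * (2 * I ^ l * (-1) ^ (l / 2))) *
      ((Real.log (Real.Gamma x) : ℂ) * (bernoulliNorm j x * clausenNorm l x)) := by
  have h1 : (j.factorial : ℂ) ≠ 0 := by exact_mod_cast j.factorial_ne_zero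
  have h2 : (2 * Real.pi * I : ℂ) ^ j ≠ 0 := pow_ne_zero _ two_pi_I_ne_zero
  have h3 : (2 * I ^ l * (-1) ^ (l / 2) : ℂ) ≠ 0 :=
    mul_ne_zero (mul_ne_zero two_ne_zero (pow_ne_zero _ I_ne_zero))
      (pow_ne_zero _ (neg_ne_zero.2 one_ne_zero))
  rw [integrand, bernoulliNorm, clausenNorm]
  generalize (2 * Real.pi * I : ℂ) ^ j = a at *
  generalize (2 * I ^ l * (-1) ^ (l / 2) : ℂ) = b at *
  push_cast
  field_simp

lemma intervalIntegrable_integrand (j l : ℕ) : IntervalIntegrable (integrand j l) volume 0 1 := by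
  have h : IntervalIntegrable (fun x => (integrand j l x : ℂ)) volume 0 1 := by
    simp only [ofReal_integrand]
    exact (intervalIntegrable_mul memLp_log_Gamma
      (memLp_bernoulliNorm_mul_clausenNorm j l)).const_mul _
  exact ⟨h.1.re, h.2.re⟩

lemma ofReal_X (j l : ℕ) :
    (X j l : ℂ) = (l.factorial : ℂ) * j.factorial / (2 * (2 * Real.pi * I) ^ (j + l)) *
      ∫ x in (0 : ℝ)..1, (Real.log (Real.Gamma x) : ℂ) *
        (bernoulliNorm j x * clausenNorm l x) := by
  rw [X, ofReal_mul, ← intervalIntegral.integral_ofReal]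
  simp only [ofReal_integrand]
  rw [intervalIntegral.integral_const_mul, ← mul_assoc]
  congr 1
  have h3 : ((-1 : ℂ) ^ (l / 2)) ≠ 0 := pow_ne_zero _ (neg_ne_zero.2 one_ne_zero)
  have hpi : (Real.pi : ℂ) ≠ 0 := ofReal_ne_zero.2 Real.pi_pos.ne'
  push_cast
  rw [pow_add, mul_pow (2 * (Real.pi : ℂ)) I l]
  field_simp

/-! ### The kernel -/

/-- The combination of products of Bernoulli and Clausen functions whose integral against
`log Γ` is, up to sign, `Y m (ν + 2)`. -/
def kernel (m ν : ℕ) (x : ℝ) : ℂ :=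
  ∑ t ∈ Finset.range (m + 1), (-1) ^ (m - t) * ((ν + t).choose t : ℂ) *
    (bernoulliNorm (m - t) x * clausenNorm (ν + t) x)

lemma memLp_kernel (m ν : ℕ) : MemLp (kernel m ν) 2 unitMeasure :=
  memLp_finsetSum (Finset.range (m + 1)) fun t _ =>
    (memLp_bernoulliNorm_mul_clausenNorm (m - t) (ν + t)).const_mul
      ((-1) ^ (m - t) * ((ν + t).choose t : ℂ))

lemma kernel_one_sub {m ν : ℕ} (h : Even (m + ν)) {x : ℝ} (hx : x ∈ Ioo (0 : ℝ) 1) :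
    kernel m ν (1 - x) = kernel m ν x := by
  refine Finset.sum_congr rfl fun t ht => ?_
  have htm : t ≤ m := by have := Finset.mem_range.1 ht; omega
  have hs : (-1 : ℂ) ^ (m - t) * (-1) ^ (ν + t) = 1 := by
    rw [← pow_add, show m - t + (ν + t) = m + ν by omega, h.neg_one_pow]
  rw [bernoulliNorm_one_sub, clausenNorm_one_sub _ hx]
  linear_combination ((-1) ^ (m - t) * ((ν + t).choose t : ℂ) *
    (bernoulliNorm (m - t) x * clausenNorm (ν + t) x)) * hs

lemma coeff_sum {ι : Type*} (s : Finset ι) (c : ι → ℂ) (f : ι → ℝ → ℂ)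
    (hf : ∀ i ∈ s, MemLp (f i) 2 unitMeasure) (k : ℤ) :
    coeff (fun x => ∑ i ∈ s, c i * f i x) k = ∑ i ∈ s, c i * coeff (f i) k := by
  have he : MemLp (expo (-k)) 2 unitMeasure :=
    MemLp.of_bound (continuous_expo _).aestronglyMeasurable 1
      (ae_of_all _ fun x => (norm_expo _ x).le)
  simp only [coeff, Finset.mul_sum]
  rw [intervalIntegral.integral_finsetSum]
  · refine Finset.sum_congr rfl fun i _ => ?_
    rw [← intervalIntegral.integral_const_mul]
    refine intervalIntegral.integral_congr fun x _ => ?_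
    ring
  · intro i hi
    exact intervalIntegrable_mul he ((hf i hi).const_mul (c i))

lemma coeff_neg_of_symm {G : ℝ → ℂ} (hsymm : ∀ x ∈ Ioo (0 : ℝ) 1, G (1 - x) = G x) (k : ℤ) :
    coeff G (-k) = coeff G k := by
  rw [coeff, ← integral_comp_one_sub, coeff]
  refine intervalIntegral.integral_congr_Ioo_of_le zero_le_one fun x hx => ?_
  have : expo (- -k) (1 - x) = expo (-k) x := by
    rw [expo_eq, expo_eq]
    refine Complex.exp_eq_exp_iff_exists_int.2 ⟨k, ?_⟩
    push_cast; ring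
  simp only [this, hsymm x hx]

/-- The term `t = m` has Bernoulli degree `0` and gives the indicator. In the others `(-1) ^ (m -
t)` turns `p - k` into `k - p`, and the `-1` of the Bernoulli coefficients produces `-fracSum`. -/
lemma hasSum_coeff_kernel (m ν : ℕ) (p : ℤ) :
    HasSum (fun k : ℤ => (k.sign : ℂ) *
      ((if p - k = 0 then ((ν + m).choose m : ℂ) / (k : ℂ) ^ (ν + m + 1) else 0) -
        fracSum (1 / ((k : ℂ) - p)) (1 / (k : ℂ)) m (ν + 1))) (coeff (kernel m ν) p) := by
  have hc : coeff (kernel m ν) p = ∑ t ∈ Finset.range (m + 1),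
      (-1) ^ (m - t) * ((ν + t).choose t : ℂ) *
        coeff (fun x => clausenNorm (ν + t) x * bernoulliNorm (m - t) x) p := by
    simp only [mul_comm (clausenNorm _ _)]
    exact coeff_sum _ _ _ (fun t _ => memLp_bernoulliNorm_mul_clausenNorm _ _) p
  rw [hc]
  have h := hasSum_sum fun t (_ : t ∈ Finset.range (m + 1)) =>
    (hasSum_coeff_mul (memLp_and_coeff_clausenNorm (ν + t)).1 (memLp_bernoulliNorm (m - t))
      p).mul_left ((-1) ^ (m - t) * ((ν + t).choose t : ℂ))
  convert! h using 2 with k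
  simp only [(memLp_and_coeff_clausenNorm _).2]
  rw [Finset.sum_range_succ, Nat.sub_self, coeff_bernoulliNorm_zero, add_comm (Finset.sum _ _), mul_sub,
    sub_eq_add_neg]
  congr 1
  · split_ifs <;> simp; ring
  · rw [fracSum, Finset.mul_sum, ← Finset.sum_neg_distrib]
    refine Finset.sum_congr rfl fun t ht => ?_
    have htm : m - t ≠ 0 := by have := Finset.mem_range.1 ht; omega
    rw [coeff_bernoulliNorm htm, show ν + 1 + t - 1 = ν + t by omega]
    push_cast
    rw [show (p : ℂ) - k = -1 * (k - p) by ring, mul_pow, one_div_pow, one_div_pow,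
      show ν + 1 + t = ν + t + 1 by omega]
    rcases neg_one_pow_eq_or ℂ (m - t) with h | h <;> rw [h] <;> ring

lemma coeff_kernel {m : ℕ} (hm : 2 ≤ m) (ν q : ℕ) :
    coeff (kernel m ν) ((q + 1 : ℕ) : ℤ) =
      -((1 - (-1) ^ m) * riemannZeta (m : ℂ) +
        (-1) ^ m * (2 * harm m q + 1 / ((q : ℂ) + 1) ^ m)) * (1 / ((q : ℂ) + 1) ^ (ν + 1)) +
      ∑ s ∈ Finset.range (ν + 1), ((m + s - 1).choose s : ℂ) *
        (1 / ((q : ℂ) + 1) ^ (ν + 1 - s)) *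
          ((1 - (-1) ^ (m + s)) * riemannZeta ((m + s : ℕ) : ℂ)) := by
  have h := hasSum_coeff_kernel m ν ((q + 1 : ℕ) : ℤ)
  simp only [sum_convolution_eq (show 0 < m by omega) ν
    (show ((q + 1 : ℕ) : ℤ) ≠ 0 by positivity)] at h
  refine h.unique ?_
  have h1 := ((hasSum_sign_div_sub_pow hm q).neg.mul_right (1 / ((q : ℂ) + 1) ^ (ν + 1))).add
    (hasSum_sum fun s (_ : s ∈ Finset.range (ν + 1)) =>
      (hasSum_sign_div_pow (show 2 ≤ m + s by omega)).mul_left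
        (((m + s - 1).choose s : ℂ) * (1 / ((q : ℂ) + 1) ^ (ν + 1 - s))))
  convert! h1 using 1
  funext k
  push_cast
  rfl

/-- At `p = 0` the two poles coincide: every term is a multiple of `sign k / k ^ (m + ν + 1)` and
the binomials add up by the hockey-stick identity. The exponent is odd, so both signs of `k`
contribute equally. -/
lemma coeff_kernel_zero {m ν : ℕ} (hm : 2 ≤ m) (h : Even (m + ν)) :
    coeff (kernel m ν) 0 =
      -2 * ((m + ν).choose (m - 1) : ℂ) * riemannZeta ((m + ν + 1 : ℕ) : ℂ) := by
  refine (hasSum_coeff_kernel m ν 0).unique ?_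
  have h1 := (hasSum_sign_div_pow (show 2 ≤ m + ν + 1 by omega)).mul_left
    (-((m + ν).choose (m - 1) : ℂ))
  rw [h.add_one.neg_one_pow] at h1
  convert! h1 using 1
  · funext k
    rcases eq_or_ne k 0 with rfl | hk
    · simp
    rw [if_neg (by simpa using hk)]
    have hch : ((m + ν).choose (m - 1) : ℂ) =
        ∑ s ∈ Finset.range m, ((ν + 1 + s - 1).choose s : ℂ) := by
      have := sum_choose_add_sub_one (show 0 < ν + 1 by omega) (m - 1)
      rw [show m - 1 + 1 = m by omega, show m - 1 + (ν + 1) = m + ν by omega] at this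
      rw [Nat.choose_symm_of_eq_add (show m + ν = m - 1 + (ν + 1) by omega)]
      exact_mod_cast this.symm
    have hf : fracSum (1 / ((k : ℂ) - (0 : ℤ))) (1 / (k : ℂ)) m (ν + 1) =
        ((m + ν).choose (m - 1) : ℂ) / (k : ℂ) ^ (m + ν + 1) := by
      rw [hch, fracSum, Finset.sum_div]
      refine Finset.sum_congr rfl fun t ht => ?_
      have := Finset.mem_range.1 ht
      rw [Int.cast_zero, sub_zero, ← pow_add, one_div_pow,
        show m - t + (ν + 1 + t) = m + ν + 1 by omega]
      ring
    rw [hf]; ring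
  · ring

/-- Parseval, folded onto positive frequencies by the symmetry of `kernel`. The weight `1 / q`
raises `q ^ (ν + 1)` to `q ^ n`, so `harm m` sums to `T m 0 n`. -/
lemma coeff_clausenNorm_mul_kernel {m ν : ℕ} (hm : 2 ≤ m) (h : Even (m + ν)) :
    coeff (fun x => clausenNorm 0 x * kernel m ν x) 0 =
      2 * (-((1 - (-1) ^ m) * riemannZeta (m : ℂ) * riemannZeta ((ν + 2 : ℕ) : ℂ) +
        (-1) ^ m * (2 * T m 0 (ν + 2) + riemannZeta ((m + (ν + 2) : ℕ) : ℂ))) +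
      ∑ s ∈ Finset.range (ν + 1), ((m + s - 1).choose s : ℂ) *
        ((1 - (-1) ^ (m + s)) * riemannZeta ((m + s : ℕ) : ℂ)) *
          riemannZeta ((ν + 2 - s : ℕ) : ℂ)) := by
  have hV := memLp_and_coeff_clausenNorm 0
  have h1 := (hasSum_coeff_mul hV.1 (memLp_kernel m ν) 0).nat_add_neg
  simp only [hV.2, zero_sub, coeff_neg_of_symm (fun x hx => kernel_one_sub h hx)] at h1
  rw [← hasSum_nat_add_iff' 1] at h1
  simp only [Finset.range_one, Finset.sum_singleton, Nat.cast_zero, Int.sign_zero, Int.cast_zero,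
    neg_zero, zero_div, zero_mul, add_zero, sub_zero] at h1
  refine h1.unique ?_
  have h2 := (((((hasSum_zeta (show 2 ≤ ν + 2 by omega)).mul_left
      ((1 - (-1) ^ m) * riemannZeta (m : ℂ))).add
    ((((hasSum_harm_div_pow hm (show 2 ≤ ν + 2 by omega)).mul_left 2).add
      (hasSum_zeta (show 2 ≤ m + (ν + 2) by omega))).mul_left ((-1) ^ m))).neg).add
    (hasSum_sum fun s (hs : s ∈ Finset.range (ν + 1)) =>
      (hasSum_zeta (show 2 ≤ ν + 2 - s by have := Finset.mem_range.1 hs; omega)).mul_left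
        (((m + s - 1).choose s : ℂ) *
          ((1 - (-1) ^ (m + s)) * riemannZeta ((m + s : ℕ) : ℂ))))).mul_left 2
  convert! h2 using 1
  funext q
  have hq : (q : ℂ) + 1 ≠ 0 := Nat.cast_add_one_ne_zero q
  have hsum : ∑ s ∈ Finset.range (ν + 1), ((m + s - 1).choose s : ℂ) *
        ((1 - (-1) ^ (m + s)) * riemannZeta ((m + s : ℕ) : ℂ)) * (1 / ((q : ℂ) + 1) ^ (ν + 2 - s)) =
      1 / ((q : ℂ) + 1) * ∑ s ∈ Finset.range (ν + 1), ((m + s - 1).choose s : ℂ) *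
        (1 / ((q : ℂ) + 1) ^ (ν + 1 - s)) *
          ((1 - (-1) ^ (m + s)) * riemannZeta ((m + s : ℕ) : ℂ)) := by
    rw [Finset.mul_sum]
    refine Finset.sum_congr rfl fun s hs => ?_
    have := Finset.mem_range.1 hs
    rw [show ν + 2 - s = ν + 1 - s + 1 by omega, pow_succ]
    field_simp
  rw [hsum, coeff_kernel hm, Int.sign_neg, Int.sign_eq_one_of_pos (by positivity)]
  push_cast
  rw [pow_add _ m (ν + 2), show ν + 2 = ν + 1 + 1 by omega, pow_succ _ (ν + 1)]
  field_simp
  ring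

/-! ### The evaluation -/

lemma ofReal_Y {m ν : ℕ} (h : Even (m + ν)) :
    (Y m (ν + 2) : ℂ) = (-1) ^ ((m + ν) / 2) *
      ∫ x in (0 : ℝ)..1, (Real.log (Real.Gamma x) : ℂ) * kernel m ν x := by
  have hI : (I : ℂ) ^ (m + ν) = (-1) ^ ((m + ν) / 2) := by
    obtain ⟨r, hr⟩ := h
    rw [hr, ← two_mul, pow_mul, I_sq, Nat.mul_div_cancel_left r two_pos]
  have hI2 : ((-1 : ℂ) ^ ((m + ν) / 2)) * (-1) ^ ((m + ν) / 2) = 1 := by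
    rw [← mul_pow]; simp
  have hint : ∫ x in (0 : ℝ)..1, (Real.log (Real.Gamma x) : ℂ) * kernel m ν x =
      ∑ t ∈ Finset.range (m + 1), (-1) ^ (m - t) * ((ν + t).choose t : ℂ) *
        ∫ x in (0 : ℝ)..1, (Real.log (Real.Gamma x) : ℂ) *
          (bernoulliNorm (m - t) x * clausenNorm (ν + t) x) := by
    simp only [kernel, Finset.mul_sum]
    rw [intervalIntegral.integral_finsetSum]
    · refine Finset.sum_congr rfl fun t _ => ?_
      rw [← intervalIntegral.integral_const_mul]
      refine intervalIntegral.integral_congr fun x _ => ?_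
      ring
    · intro t _
      exact intervalIntegrable_mul memLp_log_Gamma
        ((memLp_bernoulliNorm_mul_clausenNorm (m - t) (ν + t)).const_mul _)
  -- Reversal `j = m - t`. The power of `2πi` is `m + ν` in every term, and the factorials of `X`
  -- and `Y` combine with `m.choose t` to `(ν + t).choose t`.
  rw [hint, Y, Finset.mul_sum, Finset.mul_sum, ofReal_sum, ← Finset.sum_range_reflect]
  refine Finset.sum_congr rfl fun t ht => ?_
  have htm : t ≤ m := by have := Finset.mem_range.1 ht; omega
  rw [show m + 1 - 1 - t = m - t by omega, show m + (ν + 2) - 2 - (m - t) = ν + t by omega,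
    show m + (ν + 2) - 2 = m + ν by omega, show m + (ν + 2) - m - 2 = ν by omega,
    Nat.choose_symm htm]
  push_cast
  rw [ofReal_X, show m - t + (ν + t) = m + ν by omega, mul_pow (2 * (Real.pi : ℂ)) I, hI]
  have hf : ∀ a : ℕ, (a.factorial : ℂ) ≠ 0 := fun a => by exact_mod_cast a.factorial_ne_zero
  have hpi : (2 * (Real.pi : ℂ)) ^ (m + ν) ≠ 0 :=
    pow_ne_zero _ (mul_ne_zero two_ne_zero (ofReal_ne_zero.2 Real.pi_pos.ne'))
  have hc1 : (m.choose t : ℂ) * t.factorial * (m - t).factorial = m.factorial := by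
    exact_mod_cast Nat.choose_mul_factorial_mul_factorial htm
  have hc2 : ((ν + t).choose t : ℂ) * t.factorial * ν.factorial = (ν + t).factorial := by
    have := Nat.choose_mul_factorial_mul_factorial (Nat.le_add_left t ν)
    rw [Nat.add_sub_cancel] at this
    exact_mod_cast this
  have hc3 : (m.choose t : ℂ) ≠ 0 := by exact_mod_cast (Nat.choose_pos htm).ne'
  have he : ((-1 : ℂ) ^ ((m + ν) / 2)) ≠ 0 := pow_ne_zero _ (neg_ne_zero.2 one_ne_zero)
  rw [← hc1, ← hc2]
  generalize (2 * (Real.pi : ℂ)) ^ (m + ν) = P at *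
  generalize ((-1 : ℂ) ^ ((m + ν) / 2)) = E at *
  generalize (∫ x in (0 : ℝ)..1, (Real.log (Real.Gamma x) : ℂ) *
          (bernoulliNorm (m - t) x * clausenNorm (ν + t) x)) = J at *
  have h1 := hf t
  have h2 := hf ν
  have h3 := hf (m - t)
  field_simp
  rw [pow_two, hI2, mul_one]

/-- Only odd `m + s` survive, that is `s = ν + 1 - 2 k`. The indices `k` with `2 k > ν + 1` carry a
vanishing binomial coefficient. -/
lemma sum_choose_zeta_eq {m ν : ℕ} (hm : 2 ≤ m) (h : Even (m + ν)) :
    ∑ s ∈ Finset.range (ν + 1), ((m + s - 1).choose s : ℂ) *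
        ((1 - (-1) ^ (m + s)) * riemannZeta ((m + s : ℕ) : ℂ)) *
          riemannZeta ((ν + 2 - s : ℕ) : ℂ) =
      2 * ∑ k ∈ Finset.Icc 1 ((m + (ν + 2)) / 2 - 2),
        ((m + (ν + 2) - 2 - 2 * k).choose (m - 1) : ℂ) *
        riemannZeta ((2 * k + 1 : ℕ) : ℂ) * riemannZeta ((m + (ν + 2) - 1 - 2 * k : ℕ) : ℂ) := by
  obtain ⟨r, hr⟩ := h
  rw [Finset.mul_sum, ← Finset.sum_filter_of_ne (p := fun s => Odd (m + s)),
    ← Finset.sum_filter_of_ne (s := Finset.Icc 1 ((m + (ν + 2)) / 2 - 2))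
      (p := fun k => 2 * k ≤ ν + 1)]
  · refine Finset.sum_nbij' (fun s => (ν + 1 - s) / 2) (fun k => ν + 1 - 2 * k) ?_ ?_ ?_ ?_ ?_
    · intro s hs
      simp only [Finset.mem_filter, Finset.mem_range, Finset.mem_Icc] at hs ⊢
      obtain ⟨hs, u, hu⟩ := hs
      omega
    · intro k hk
      simp only [Finset.mem_filter, Finset.mem_range, Finset.mem_Icc] at hk ⊢
      exact ⟨by omega, r - k, by omega⟩
    · intro s hs
      simp only [Finset.mem_filter, Finset.mem_range] at hs
      obtain ⟨hs, u, hu⟩ := hs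
      omega
    · intro k hk
      simp only [Finset.mem_filter, Finset.mem_Icc] at hk
      omega
    · intro s hs
      simp only [Finset.mem_filter, Finset.mem_range] at hs
      obtain ⟨hs, hodd⟩ := hs
      rw [hodd.neg_one_pow]
      obtain ⟨u, hu⟩ := hodd
      rw [show 2 * ((ν + 1 - s) / 2) + 1 = ν + 2 - s by omega,
        show m + (ν + 2) - 1 - 2 * ((ν + 1 - s) / 2) = m + s by omega,
        show m + (ν + 2) - 2 - 2 * ((ν + 1 - s) / 2) = m + s - 1 by omega,
        Nat.choose_symm_of_eq_add (show m + s - 1 = s + (m - 1) by omega)]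
      ring
  · intro k _ hk
    by_contra hlt
    exact hk (by rw [Nat.choose_eq_zero_of_lt (by omega)]; simp)
  · intro s _ hs
    by_contra hev
    exact hs (by rw [(Nat.not_odd_iff_even.1 hev).neg_one_pow]; simp)

lemma T₂_eq {m ν : ℕ} (hm : 2 ≤ m) (h : Even (m + ν)) :
    T₂ m (ν + 2) = -(1 / 2) * ((1 - (-1) ^ m) * riemannZeta (m : ℂ) *
      riemannZeta ((ν + 2 : ℕ) : ℂ) +
        (-1) ^ m * (2 * T m 0 (ν + 2) + riemannZeta ((m + (ν + 2) : ℕ) : ℂ))) := by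
  have h1 := two_mul_integral_log_Gamma_mul (memLp_kernel m ν) (fun x hx => kernel_one_sub h hx)
  rw [coeff_kernel_zero hm h, coeff_clausenNorm_mul_kernel hm h, sum_choose_zeta_eq hm h] at h1
  have hE : ((-1 : ℂ) ^ ((m + ν) / 2)) * (-1) ^ ((m + ν) / 2) = 1 := by
    rw [← mul_pow]; simp
  rw [T₂, Ystar, ofReal_Y h, show (m + (ν + 2)) / 2 - 1 = (m + ν) / 2 by omega,
    show m + (ν + 2) - 2 = m + ν by omega, show m + (ν + 2) - 1 = m + ν + 1 by omega]
  rw [show m + (ν + 2) - 2 = m + ν by omega, show m + (ν + 2) - 1 = m + ν + 1 by omega] at h1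
  generalize ((-1 : ℂ) ^ ((m + ν) / 2)) = E at *
  -- `E = (-1) ^ (N / 2 - 1)` occurs both in front of `Y*` and inside it, hence `E * E = 1`; the
  -- `log 2π` terms then cancel.
  linear_combination (1 / 2) * h1 + ((∫ x in (0 : ℝ)..1, (Real.log (Real.Gamma x) : ℂ) *
    kernel m ν x) + ((m + ν).choose (m - 1) : ℂ) * riemannZeta ((m + ν + 1 : ℕ) : ℂ) *
      (Real.log (2 * Real.pi) : ℂ)) * hE

end Tornheim

end

theorem theorem2p3 (m n : ℕ) (hm : 2 ≤ m) (hn : 2 ≤ n) (hN : Even (m + n)) :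
    -- the double series converges
    Summable (fun p : ℕ × ℕ => Tornheim.term m 0 n p.1 p.2) ∧
    -- the Clausen series and the integrals `X_{k,l}` with `k + l = N - 2` converge
    (∀ k l : ℕ, k + l = m + n - 2 →
      (∀ q ∈ Set.Ioo (0 : ℝ) 1,
        Summable (Tornheim.clausenTerm (l + 1) (2 * Real.pi * q))
          (SummationFilter.conditional ℕ)) ∧
      IntervalIntegrable (Tornheim.integrand k l) MeasureTheory.volume 0 1) ∧
    -- the evaluation
    (Odd m → Odd n →
      (Tornheim.T m 0 n : ℂ) = Tornheim.T₁ m n + Tornheim.T₂ m n) ∧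
    (Even m → Even n →
      (Tornheim.T m 0 n : ℂ) = Tornheim.T₁ m n + Tornheim.T₂ n m) := by
  refine ⟨Tornheim.summable_term hm hn, fun k l _ =>
    ⟨fun q hq => Tornheim.summable_clausenTerm l hq, Tornheim.intervalIntegrable_integrand k l⟩,
    fun hmo _ => ?_, fun _ hne => ?_⟩
  · obtain ⟨ν, rfl⟩ : ∃ ν, n = ν + 2 := ⟨n - 2, by omega⟩
    rw [Tornheim.T₂_eq hm (by rw [← add_assoc] at hN; simpa [Nat.even_add] using hN),
      hmo.neg_one_pow, Tornheim.T₁]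
    ring
  -- For even exponents `T₂(n, m)` is `-T(n, 0, m) - ζ(N) / 2`, which the swap relation converts to
  -- `T(m, 0, n)`.
  · have hswap := Tornheim.T_add_T_swap hm hn
    obtain ⟨μ, rfl⟩ : ∃ μ, m = μ + 2 := ⟨m - 2, by omega⟩
    rw [Tornheim.T₂_eq hn (by rw [add_right_comm, add_comm μ] at hN; simpa [Nat.even_add] using hN),
      hne.neg_one_pow, Tornheim.T₁, add_comm n (μ + 2)]
    linear_combination hswap
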